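/- Let $G$ be a finite simple undirected graph and let $\chi\colon V(G)\times V(G)\to C$ be a coloring of the pairs of vertices that is 2-stable, i.e., a stable coloring with respect to the 2-dimensional Weisfeiler-Leman algorithm on $G$: (i) if $\chi(v,w)=\chi(v',w')$, then $v=w \Leftrightarrow v'=w'$ and $vw\in E(G)\Leftrightarrow v'w'\in E(G)$; (ii) if $\chi(v,w)=\chi(v',w')$, then the multisets $\{\!\{(\chi(x,w),\chi(v,x)) \mid x\in V(G)\}\!\}$ and $\{\!\{(\chi(x,w'),\chi(v',x)) \mid x\in V(G)\}\!\}$ are equal. Let $C_V=\{\chi(v,v)\mid v\in V(G)\}$ be the set of vertex colors and, for $c\in C_V$, let $V_c=\{v\in V(G)\mid \chi(v,v)=c\}$. Let $G[[\chi]]$ be the graph with vertex set $C_V$ in which two distinct colors $c_1,c_2$ are adjacent if and only if there are $v_1\in V_{c_1}$ and $v_2\in V_{c_2}$ with $v_1v_2\in E(G)$. Suppose that $G[[\chi]]$ is connected (in particular non-empty) and that $|V_c|\ge 3$ for every $c\in C_V$. Then there are pairwise vertex-disjoint connected subgraphs $H_1,H_2,H_3\subseteq G$ such that $V(H_r)\cap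 V_c\neq\emptyset$ for all $r\in\{1,2,3\}$ and all $c\in C_V$. -/

import Mathlib

/-- `χ₁ ⪯ χ₂`: the coloring `χ₁` of the pairs of vertices refines the coloring `χ₂`. -/
def PairRefines {V C D : Type*} (χ₁ : V → V → C) (χ₂ : V → V → D) : Prop :=
  ∀ v w v' w' : V, χ₁ v w = χ₁ v' w' → χ₂ v w = χ₂ v' w'

/-- `χ₁ ≡ χ₂`: the two colorings refine each other. -/
def PairEquiv {V C D : Type*} (χ₁ : V → V → C) (χ₂ : V → V → D) : Prop :=
  PairRefines χ₁ χ₂ ∧ PairRefines χ₂ χ₁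

/-- The initial coloring of 2-dimensional Weisfeiler-Leman: the isomorphism type of the ordered
subgraph on `(v, w)`.  As `G` has no loops and is undirected, this type consists of the truth
values of `v = w` and `vw ∈ E(G)`. -/
def wlInit {V : Type*} (G : SimpleGraph V) : V → V → Prop × Prop :=
  fun v w => (v = w, G.Adj v w)

/-- One round of 2-dimensional Weisfeiler-Leman: the pair `(v, w)` gets its old color together
with the multiset of the pairs `(χ(x, w), χ(v, x))` over all vertices `x`. -/
def wlRound {V C : Type*} [Fintype V] (χ : V → V → C) : V → V → C × Multiset (C × C) :=
  fun v w => (χ v w, (Finset.univ : Finset V).val.map fun x => (χ x w, χ v x))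

/-- `χ` is a 2-stable coloring of `G`: it refines the initial coloring, and a round of
2-dimensional Weisfeiler-Leman does not refine it any further. -/
def IsTwoStable {V C : Type*} [Fintype V] (G : SimpleGraph V) (χ : V → V → C) : Prop :=
  PairRefines χ (wlInit G) ∧ PairEquiv (wlRound χ) χ

/-- The set `C_V` of vertex colors, i.e. the colors `χ(v, v)`. -/
def vertexColors {V C : Type*} (χ : V → V → C) : Set C :=
  Set.range fun v => χ v v

/-- The vertex color class `V_c = {v | χ(v, v) = c}`. -/
def colorClass {V C : Type*} (χ : V → V → C) (c : C) : Set V :=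
  {v | χ v v = c}

/-- The color graph `G[[χ]]`: its vertices are the vertex colors, and two distinct colors are
adjacent if there is an edge of `G` between their classes. -/
def colorGraph {V C : Type*} (G : SimpleGraph V) (χ : V → V → C) :
    SimpleGraph (vertexColors χ) where
  Adj c₁ c₂ := c₁ ≠ c₂ ∧ ∃ v₁ ∈ colorClass χ (c₁ : C), ∃ v₂ ∈ colorClass χ (c₂ : C), G.Adj v₁ v₂
  symm := ⟨fun _ _ h => by
    obtain ⟨hne, v₁, h₁, v₂, h₂, hadj⟩ := h
    exact ⟨hne.symm, v₂, h₂, v₁, h₁, hadj.symm⟩⟩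
  loopless := ⟨fun _ h => h.1 rfl⟩

/-! Edges inside color classes are dropped, and `exists_isTripleModel` runs an induction on a set
`A` of colors, looking for three disjoint connected sets that each meet all classes of `A`.

Suppose that colors c and d are linked and some vertex of color c has only one neighbor of color d.
By coherence this holds for all vertices of color c, so class c can be contracted into class d, and
a model of the smaller system lifts (`IsTripleModel.of_contractColor`).

Otherwise, delete a color i whose removal keeps the color graph connected, and take a model of the
rest. Each of its parts has at least two neighbors in V_i. By a Hall-type argument, either distinct
representatives extend the model, or all three parts see the same two vertices a, b
(`IsTripleModel.exists_pair`). In the second case, if the graph on `A` is disconnected, a further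
component serves as the third part. If it is connected, all attached vertices in one component of
the graph without class i have the same neighbors in V_i, and these are not all of V_i
(`isSeparatorColor_of_not_exists`).

A connected color graph with at least two colors has two removable ones. With a third color present,
they cannot both behave in this way (`IsSeparatorColor.false_of_two`); the case of two colors is
settled directly (`exists_isTripleModel_pair`). -/

/-- `S` is connected with respect to the relation `r`: every bipartition of `S` into nonempty parts
is crossed by `r`. -/
def CutConnected {α : Type*} (r : α → α → Prop) (S : Set α) : Prop :=
  ∀ X : Set α, (∃ x ∈ S, x ∈ X) → (∃ y ∈ S, y ∉ X) → ∃ x ∈ S, x ∈ X ∧ ∃ y ∈ S, y ∉ X ∧ r x y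

/-! ### Connectivity expressed by cuts -/

namespace CutConnected

variable {α : Type*} {r : α → α → Prop} {S : Set α}

theorem singleton (a : α) : CutConnected r {a} := by
  rintro X ⟨x, rfl, hx⟩ ⟨y, rfl, hy⟩
  exact absurd hx hy

theorem insert (hr : ∀ x y, r x y → r y x) (h : CutConnected r S) {a b : α} (hb : b ∈ S)
    (hab : r b a) : CutConnected r (insert a S) := by
  rintro X ⟨x, hx, hxX⟩ ⟨y, hy, hyX⟩
  by_cases hbX : b ∈ X
  · by_cases haX : a ∈ X
    · have hyS : y ∈ S := by
        rcases hy with rfl | hy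
        · exact absurd haX hyX
        · exact hy
      obtain ⟨p, hp, hpX, q, hq, hqX, hpq⟩ := h X ⟨b, hb, hbX⟩ ⟨y, hyS, hyX⟩
      exact ⟨p, Or.inr hp, hpX, q, Or.inr hq, hqX, hpq⟩
    · exact ⟨b, Or.inr hb, hbX, a, Or.inl rfl, haX, hab⟩
  · by_cases haX : a ∈ X
    · exact ⟨a, Or.inl rfl, haX, b, Or.inr hb, hbX, hr _ _ hab⟩
    · have hxS : x ∈ S := by
        rcases hx with rfl | hx
        · exact absurd hxX haX
        · exact hx
      obtain ⟨p, hp, hpX, q, hq, hqX, hpq⟩ := h X ⟨x, hxS, hxX⟩ ⟨b, hb, hbX⟩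
      exact ⟨p, Or.inr hp, hpX, q, Or.inr hq, hqX, hpq⟩

/-- A finite connected set has, next to any prescribed element, another element whose removal
leaves it connected. -/
theorem exists_erase [DecidableEq α] (hr : ∀ x y, r x y → r y x) {A : Finset α}
    (h : CutConnected r (A : Set α)) {a b : α} (ha : a ∈ A) (hb : b ∈ A) (hab : b ≠ a) :
    ∃ j ∈ A, j ≠ a ∧ CutConnected r (A.erase j : Set α) := by
  classical
  -- A largest proper connected subset containing `a` misses exactly one element: an edge leaving it
  -- yields a larger connected set, which must be all of `A`.
  let F := A.powerset.filter fun B => a ∈ B ∧ B ≠ A ∧ CutConnected r (B : Set α)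
  have hF : F.Nonempty := by
    refine ⟨{a}, ?_⟩
    simp only [F, Finset.mem_filter, Finset.mem_powerset, Finset.singleton_subset_iff,
      Finset.mem_singleton, true_and, Finset.coe_singleton]
    refine ⟨ha, ?_, singleton a⟩
    rintro rfl
    exact hab (Finset.mem_singleton.1 hb)
  obtain ⟨B, hB, hmax⟩ := F.exists_max_image Finset.card hF
  simp only [F, Finset.mem_filter, Finset.mem_powerset] at hB hmax
  obtain ⟨hBA, haB, hne, hc⟩ := hB
  have hex : ∃ y ∈ A, y ∉ B := by
    by_contra! hcon
    exact hne (hBA.antisymm hcon)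
  obtain ⟨p, -, hpB, q, hqA, hqB, hpq⟩ := h (B : Set α) ⟨a, ha, haB⟩ hex
  have hc' : CutConnected r (Insert.insert q B : Finset α) := by
    rw [Finset.coe_insert]
    exact hc.insert hr hpB hpq
  have hEq : Insert.insert q B = A := by
    by_contra hneA
    have := hmax (Insert.insert q B) ⟨Finset.insert_subset hqA hBA,
      Finset.mem_insert_of_mem haB, hneA, hc'⟩
    rw [Finset.card_insert_of_notMem (by simpa using hqB)] at this
    omega
  refine ⟨q, hqA, fun hqa => hqB (by simpa [hqa] using haB), ?_⟩
  rw [← hEq, Finset.erase_insert (by simpa using hqB)]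
  exact hc

/-- The set of all elements reachable from a given one is connected. -/
theorem reachable (hr : ∀ x y, r x y → r y x) (v : α) :
    CutConnected r {w | Relation.ReflTransGen r v w} := by
  have key : ∀ (X : Set α) (y : α), Relation.ReflTransGen r v y → v ∈ X → y ∉ X →
      ∃ p q, Relation.ReflTransGen r v p ∧ p ∈ X ∧ Relation.ReflTransGen r v q ∧ q ∉ X ∧ r p q := by
    intro X y hy hv
    induction hy with
    | refl => exact fun h => absurd hv h
    | @tail b c hvb hbc ih =>
      intro hc
      by_cases hb : b ∈ X
      · exact ⟨b, c, hvb, hb, hvb.tail hbc, hc, hbc⟩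
      · exact ih hb
  rintro X ⟨x, hx, hxX⟩ ⟨y, hy, hyX⟩
  by_cases hv : v ∈ X
  · obtain ⟨p, q, hp, hpX, hq, hqX, hpq⟩ := key X y hy hv hyX
    exact ⟨p, hp, hpX, q, hq, hqX, hpq⟩
  · obtain ⟨p, q, hp, hpX, hq, hqX, hpq⟩ := key Xᶜ x hx hv (by simpa using hxX)
    exact ⟨q, hq, by simpa using hqX, p, hp, hpX, hr _ _ hpq⟩

theorem mono {s : α → α → Prop} (h : CutConnected r S) (hrs : ∀ x y, r x y → s x y) :
    CutConnected s S := by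
  intro X hx hy
  obtain ⟨p, hp, hpX, q, hq, hqX, hpq⟩ := h X hx hy
  exact ⟨p, hp, hpX, q, hq, hqX, hrs _ _ hpq⟩

/-- A connected set that is closed under a relation contains everything it can reach. -/
theorem subset_of_closed (h : CutConnected r S) {T : Set α} {a : α} (ha : a ∈ S) (haT : a ∈ T)
    (hT : ∀ x ∈ T, ∀ y ∈ S, r x y → y ∈ T) : S ⊆ T := by
  intro y hy
  by_contra hyT
  obtain ⟨p, -, hpT, q, hq, hqT, hpq⟩ := h T ⟨a, ha, haT⟩ ⟨y, hy, hyT⟩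
  exact hqT (hT p hpT q hq hpq)

/-- A connected vertex set of a graph spans a connected subgraph. -/
theorem subgraph_connected {G : SimpleGraph α} (h : CutConnected G.Adj S) (hS : S.Nonempty) :
    ((⊤ : G.Subgraph).induce S).Connected := by
  obtain ⟨a, ha⟩ := hS
  rw [SimpleGraph.Subgraph.connected_iff', SimpleGraph.connected_iff_exists_forall_reachable]
  refine ⟨⟨a, ha⟩, ?_⟩
  have hsub := h.subset_of_closed
    (T := {y | ∃ hy : y ∈ S, ((⊤ : G.Subgraph).induce S).coe.Reachable ⟨a, ha⟩ ⟨y, hy⟩}) ha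
    ⟨ha, SimpleGraph.Reachable.refl _⟩ (by
      rintro x ⟨hx, hax⟩ y hy hxy
      refine ⟨hy, hax.trans (SimpleGraph.Adj.reachable ?_)⟩
      exact ⟨hx, hy, hxy⟩)
  rintro ⟨y, hy⟩
  exact (hsub hy).2

end CutConnected

/-! ### Distinct representatives -/

/-- Three sets with at least two elements each have distinct representatives, unless they are
all contained in one pair. -/
theorem exists_distinct_or_subset_pair {α : Type*} (N : Fin 3 → Set α)
    (hne : ∀ r, (N r).Nonempty) (h : ∀ r y, ∃ z ∈ N r, z ≠ y) :
    (∃ z : Fin 3 → α, Function.Injective z ∧ ∀ r, z r ∈ N r) ∨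
      ∃ a b, a ≠ b ∧ ∀ r, ∀ z ∈ N r, z = a ∨ z = b := by
  rw [or_iff_not_imp_left]
  intro hno
  have hno' : ∀ x ∈ N 0, ∀ y ∈ N 1, ∀ z ∈ N 2, x ≠ y → x ≠ z → y ≠ z → False := by
    intro x hx y hy z hz hxy hxz hyz
    refine hno ⟨![x, y, z], ?_, ?_⟩
    · intro i j hij
      fin_cases i <;> fin_cases j <;> simp_all
    · intro i
      fin_cases i <;> simpa
  obtain ⟨a, ha⟩ := hne 0
  obtain ⟨b, hb, hba⟩ := h 0 a
  have h1 : ∀ z ∈ N 1, z = a ∨ z = b := by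
    intro c hc
    by_contra! hcon
    -- `c` represents `N 1`, `e` represents `N 2`, and whichever of `a`, `b` differs from `e`
    -- represents `N 0`.
    obtain ⟨e, he, hec⟩ := h 2 c
    by_cases hea : e = a
    · subst hea
      exact hno' b hb c hc e he hcon.2.symm hba hec.symm
    · exact hno' a ha c hc e he hcon.1.symm (Ne.symm hea) hec.symm
  have h2 : ∀ z ∈ N 2, z = a ∨ z = b := by
    intro c hc
    by_contra! hcon
    obtain ⟨e, he, hec⟩ := h 1 c
    by_cases hea : e = a
    · subst hea
      exact hno' b hb e he c hc hba hcon.2.symm hec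
    · exact hno' a ha e he c hc (Ne.symm hea) hcon.1.symm hec
  refine ⟨a, b, hba.symm, fun r => ?_⟩
  fin_cases r
  · intro c hc
    by_contra! hcon
    obtain ⟨d, hd, hdb⟩ := h 1 b
    obtain ⟨e, he, hea⟩ := h 2 a
    obtain rfl := (h1 d hd).resolve_right hdb
    obtain rfl := (h2 e he).resolve_left hea
    exact hno' c hc d hd e he hcon.1 hcon.2 hba.symm
  · exact h1
  · exact h2

/-! ### Coherent colorings and the relations they determine -/

/-- The part of 2-stability that does not refer to a graph: the diagonal is recognized, and equally
colored pairs have the same colors of paths of length two. -/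
structure IsCoherent {V C : Type*} (χ : V → V → C) : Prop where
  diag : ∀ v w v' w', χ v w = χ v' w' → v = w → v' = w'
  tri : ∀ v w v' w', χ v w = χ v' w' → ∀ x, ∃ x', χ v' x' = χ v x ∧ χ x' w' = χ x w

/-- The relation `R` is a union of color classes of pairs. -/
def Respects {V C : Type*} (χ : V → V → C) (R : V → V → Prop) : Prop :=
  ∀ v w v' w', χ v w = χ v' w' → R v w → R v' w'

namespace IsCoherent

variable {V C : Type*} {χ : V → V → C}

/-- The path v, v, w must be matched by a path from v' to w' whose first step is again a loop. -/
theorem color_left (h : IsCoherent χ) {v w v' w' : V} (hc : χ v w = χ v' w') :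
    χ v v = χ v' v' := by
  obtain ⟨x, hx, -⟩ := h.tri _ _ _ _ hc v
  obtain rfl := h.diag _ _ _ _ hx.symm rfl
  exact hx.symm

theorem color_right (h : IsCoherent χ) {v w v' w' : V} (hc : χ v w = χ v' w') :
    χ w w = χ w' w' := by
  obtain ⟨x, -, hx⟩ := h.tri _ _ _ _ hc w
  obtain rfl := h.diag _ _ _ _ hx.symm rfl
  exact hx.symm

theorem exists_color_eq (h : IsCoherent χ) {v v' : V} (hc : χ v v = χ v' v') (w : V) :
    ∃ w', χ v w = χ v' w' := by
  obtain ⟨x, hx, -⟩ := h.tri _ _ _ _ hc w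
  exact ⟨x, hx.symm⟩

theorem respects_left (h : IsCoherent χ) (P : C → Prop) : Respects χ fun v _ => P (χ v v) :=
  fun _ _ _ _ hc (hp : P _) => show P _ from h.color_left hc ▸ hp

theorem respects_right (h : IsCoherent χ) (P : C → Prop) : Respects χ fun _ w => P (χ w w) :=
  fun _ _ _ _ hc (hp : P _) => show P _ from h.color_right hc ▸ hp

theorem respects_ne (h : IsCoherent χ) : Respects χ fun v w => v ≠ w :=
  fun _ _ _ _ hc hne heq => hne (h.diag _ _ _ _ hc.symm heq)

end IsCoherent

namespace Respects

variable {V C : Type*} {χ : V → V → C} {R S : V → V → Prop}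

theorem and (hR : Respects χ R) (hS : Respects χ S) : Respects χ fun v w => R v w ∧ S v w :=
  fun _ _ _ _ hc h => ⟨hR _ _ _ _ hc h.1, hS _ _ _ _ hc h.2⟩

theorem or (hR : Respects χ R) (hS : Respects χ S) : Respects χ fun v w => R v w ∨ S v w :=
  fun _ _ _ _ hc h => h.imp (hR _ _ _ _ hc) (hS _ _ _ _ hc)

theorem not (hR : Respects χ R) : Respects χ fun v w => ¬ R v w :=
  fun _ _ _ _ hc h h' => h (hR _ _ _ _ hc.symm h')

theorem comp (hR : Respects χ R) (hS : Respects χ S) (h : IsCoherent χ) :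
    Respects χ fun v w => ∃ x, R v x ∧ S x w := by
  rintro v w v' w' hc ⟨x, hvx, hxw⟩
  obtain ⟨x', h1, h2⟩ := h.tri _ _ _ _ hc x
  exact ⟨x', hR _ _ _ _ h1.symm hvx, hS _ _ _ _ h2.symm hxw⟩

theorem reflTransGen (hR : Respects χ R) (h : IsCoherent χ) :
    Respects χ (Relation.ReflTransGen R) := by
  intro v w v' w' hc hvw
  induction hvw generalizing w' with
  | refl =>
    rw [h.diag _ _ _ _ hc rfl]
  | tail _ hbc ih =>
    obtain ⟨x', h1, h2⟩ := h.tri _ _ _ _ hc _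
    exact (ih _ h1.symm).tail (hR _ _ _ _ h2.symm hbc)

end Respects

/-! ### Cross graphs and triple models -/

/-- Adjacency of `G` is determined by the colors of pairs, and no edge joins two vertices of the
same color. -/
structure IsCrossGraph {V C : Type*} (χ : V → V → C) (G : SimpleGraph V) : Prop where
  respects : Respects χ G.Adj
  ne_color : ∀ v w, G.Adj v w → χ v v ≠ χ w w

/-- Some edge of `G` joins a vertex of color `c` to a vertex of color `d`. -/
def ColorLink {V C : Type*} (χ : V → V → C) (G : SimpleGraph V) (c d : C) : Prop :=
  ∃ v w, χ v v = c ∧ χ w w = d ∧ G.Adj v w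

/-- Adjacency between vertices whose colors lie in `B`. -/
def AdjIn {V C : Type*} (χ : V → V → C) (G : SimpleGraph V) (B : Finset C) (v w : V) : Prop :=
  χ v v ∈ B ∧ χ w w ∈ B ∧ G.Adj v w

/-- Three disjoint connected sets of vertices with colors in `B`, each containing vertices of all
the colors in `B`. -/
structure IsTripleModel {V C : Type*} (χ : V → V → C) (G : SimpleGraph V) (B : Finset C)
    (S : Fin 3 → Set V) : Prop where
  disj : ∀ r s v, v ∈ S r → v ∈ S s → r = s
  conn : ∀ r, CutConnected G.Adj (S r)
  color_mem : ∀ r, ∀ v ∈ S r, χ v v ∈ B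
  meets : ∀ r, ∀ c ∈ B, ∃ v ∈ S r, χ v v = c

section Models

variable {V C : Type*} {χ : V → V → C} {G : SimpleGraph V} {B : Finset C}

theorem ColorLink.symm {c d : C} (h : ColorLink χ G c d) : ColorLink χ G d c := by
  obtain ⟨v, w, hv, hw, hvw⟩ := h
  exact ⟨w, v, hw, hv, hvw.symm⟩

theorem AdjIn.symm {v w : V} (h : AdjIn χ G B v w) : AdjIn χ G B w v :=
  ⟨h.2.1, h.1, h.2.2.symm⟩

theorem ColorLink.exists_adj (h : IsCoherent χ) (hG : IsCrossGraph χ G) {c d : C}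
    (hl : ColorLink χ G c d) {v : V} (hv : χ v v = c) : ∃ w, χ w w = d ∧ G.Adj v w := by
  obtain ⟨v₀, w₀, hv₀, hw₀, hadj⟩ := hl
  obtain ⟨w, hw⟩ := h.exists_color_eq (hv₀.trans hv.symm) w₀
  exact ⟨w, (h.color_right hw).symm.trans hw₀, hG.respects _ _ _ _ hw hadj⟩

theorem IsCrossGraph.respects_adjIn (h : IsCoherent χ) (hG : IsCrossGraph χ G) (B : Finset C) :
    Respects χ (AdjIn χ G B) :=
  (h.respects_left (· ∈ B)).and ((h.respects_right (· ∈ B)).and hG.respects)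

theorem reachable_symm {v w : V} (h : Relation.ReflTransGen (AdjIn χ G B) v w) :
    Relation.ReflTransGen (AdjIn χ G B) w v := by
  induction h with
  | refl => exact .refl
  | tail _ hbc ih => exact .head hbc.symm ih

theorem color_mem_of_reachable {v w : V} (h : Relation.ReflTransGen (AdjIn χ G B) v w)
    (hv : χ v v ∈ B) : χ w w ∈ B := by
  induction h with
  | refl => exact hv
  | tail _ hbc _ => exact hbc.2.1

theorem mem_of_reachable {T : Set V} (hT : ∀ v ∈ T, ∀ w, AdjIn χ G B v w → w ∈ T) {v w : V}
    (h : Relation.ReflTransGen (AdjIn χ G B) v w) (hv : v ∈ T) : w ∈ T := by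
  induction h with
  | refl => exact hv
  | tail _ hbc ih => exact hT _ ih _ hbc

/-- A set of vertices closed under adjacency meets every color class. -/
theorem exists_mem_of_closed (h : IsCoherent χ) (hG : IsCrossGraph χ G)
    (hB : CutConnected (ColorLink χ G) (B : Set C)) {T : Set V}
    (hT : ∀ v ∈ T, ∀ w, AdjIn χ G B v w → w ∈ T) {v : V} (hv : v ∈ T) (hvB : χ v v ∈ B)
    {c : C} (hc : c ∈ B) : ∃ w ∈ T, χ w w = c := by
  refine hB.subset_of_closed (T := {c | ∃ w ∈ T, χ w w = c ∧ c ∈ B}) hvB ⟨v, hv, rfl, hvB⟩ ?_ hc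
    |>.imp fun _ hw => ⟨hw.1, hw.2.1⟩
  rintro p ⟨w, hw, rfl, hwB⟩ q hq hpq
  obtain ⟨x, hx, hwx⟩ := hpq.exists_adj h hG rfl
  exact ⟨x, hT w hw x ⟨hwB, hx ▸ hq, hwx⟩, hx, hq⟩

theorem exists_reachable_color (h : IsCoherent χ) (hG : IsCrossGraph χ G)
    (hB : CutConnected (ColorLink χ G) (B : Set C)) {v : V} (hvB : χ v v ∈ B)
    {c : C} (hc : c ∈ B) : ∃ w, Relation.ReflTransGen (AdjIn χ G B) v w ∧ χ w w = c :=
  exists_mem_of_closed h hG hB (T := {w | Relation.ReflTransGen (AdjIn χ G B) v w})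
    (fun _ hx _ hxy => hx.tail hxy) .refl hvB hc

theorem cutConnected_reachable (v : V) :
    CutConnected G.Adj {w | Relation.ReflTransGen (AdjIn χ G B) v w} :=
  (CutConnected.reachable (fun _ _ h => h.symm) v).mono fun _ _ h => h.2.2

theorem isTripleModel_singleton {j : C} {x : Fin 3 → V} (hx : Function.Injective x)
    (hxj : ∀ r, χ (x r) (x r) = j) : IsTripleModel χ G {j} fun r => {x r} := by
  refine ⟨?_, fun r => .singleton _, ?_, ?_⟩
  · rintro r s v rfl hs
    exact hx hs
  · rintro r v rfl
    exact Finset.mem_singleton.2 (hxj r)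
  · intro r c hc
    exact ⟨x r, rfl, (hxj r).trans (Finset.mem_singleton.1 hc).symm⟩

/-- A triple model can be chosen such that its vertex set is closed under adjacency. -/
theorem IsTripleModel.exists_closed [Finite V] {S₀ : Fin 3 → Set V}
    (hS₀ : IsTripleModel χ G B S₀) : ∃ S, IsTripleModel χ G B S ∧
      ∀ r, ∀ v ∈ S r, ∀ w, AdjIn χ G B v w → ∃ s, w ∈ S s := by
  -- In a maximal model no neighbor `w` can lie outside all parts, since it could be added to the
  -- part it is attached to.
  obtain ⟨S, hS, hmax⟩ := (Set.toFinite {S | IsTripleModel χ G B S}).exists_maximal ⟨S₀, hS₀⟩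
  refine ⟨S, hS, fun r v hv w hvw => ?_⟩
  by_contra! hw
  have hle : S ≤ Function.update S r (insert w (S r)) := by
    intro s
    by_cases hs : s = r
    · subst hs
      rw [Function.update_self]
      exact Set.subset_insert _ _
    · rw [Function.update_of_ne hs]
  have hmem : ∀ s x, x ∈ Function.update S r (insert w (S r)) s → x ∈ S s ∨ (s = r ∧ x = w) := by
    intro s x hx
    by_cases hs : s = r
    · subst hs
      rw [Function.update_self] at hx
      exact hx.elim (fun h => .inr ⟨rfl, h⟩) .inl
    · rw [Function.update_of_ne hs] at hx
      exact .inl hx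
  have hS' : IsTripleModel χ G B (Function.update S r (insert w (S r))) := by
    refine ⟨?_, ?_, ?_, ?_⟩
    · intro s t x hs ht
      rcases hmem s x hs with hs' | ⟨hsr, hxw⟩ <;> rcases hmem t x ht with ht' | ⟨htr, hxw'⟩
      · exact hS.disj _ _ _ hs' ht'
      · exact absurd (hxw' ▸ hs') (hw _)
      · exact absurd (hxw ▸ ht') (hw _)
      · exact hsr.trans htr.symm
    · intro s
      by_cases hs : s = r
      · subst hs
        rw [Function.update_self]
        exact (hS.conn s).insert (fun _ _ h => h.symm) hv hvw.2.2
      · rw [Function.update_of_ne hs]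
        exact hS.conn s
    · intro s x hx
      rcases hmem s x hx with hx | ⟨-, rfl⟩
      · exact hS.color_mem _ _ hx
      · exact hvw.2.1
    · intro s c hc
      obtain ⟨x, hx, hxc⟩ := hS.meets s c hc
      exact ⟨x, hle s hx, hxc⟩
  refine hw r (hmax hS' hle r ?_)
  rw [Function.update_self]
  exact Set.mem_insert _ _

end Models

/-! ### Contracting one color into another -/

section Contraction

variable {V C : Type*} {χ : V → V → C} {G : SimpleGraph V}

/-- The graph in which the vertices of color `c` serve as connections between their neighbors of
color `d` and their other neighbors. -/
def contractColor (χ : V → V → C) (G : SimpleGraph V) (c d : C) : SimpleGraph V where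
  Adj v w := G.Adj v w ∨
    (χ v v = d ∧ χ w w ≠ d ∧ ∃ x, (G.Adj v x ∧ χ x x = c) ∧ G.Adj x w) ∨
    (χ v v ≠ d ∧ χ w w = d ∧ ∃ x, (G.Adj v x ∧ χ x x = c) ∧ G.Adj x w)
  symm := ⟨by
    rintro v w (h | ⟨hv, hw, x, ⟨h1, h2⟩, h3⟩ | ⟨hv, hw, x, ⟨h1, h2⟩, h3⟩)
    · exact .inl h.symm
    · exact .inr (.inr ⟨hw, hv, x, ⟨h3.symm, h2⟩, h1.symm⟩)
    · exact .inr (.inl ⟨hw, hv, x, ⟨h3.symm, h2⟩, h1.symm⟩)⟩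
  loopless := ⟨by
    rintro v (h | ⟨hv, hw, -⟩ | ⟨hv, hw, -⟩)
    · exact G.irrefl h
    · exact hw hv
    · exact hv hw⟩

/-- The new adjacency is composed of relations that respect `χ`. Exactly one end of an added edge
has color `d`, which keeps its ends differently colored. -/
theorem IsCrossGraph.contractColor (h : IsCoherent χ) (hG : IsCrossGraph χ G) (c d : C) :
    IsCrossGraph χ (contractColor χ G c d) where
  respects :=
    have hx := (hG.respects.and (h.respects_right (· = c))).comp hG.respects h
    hG.respects.or <|
      ((h.respects_left (· = d)).and ((h.respects_right (· ≠ d)).and hx)).or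
        ((h.respects_left (· ≠ d)).and ((h.respects_right (· = d)).and hx))
  ne_color := by
    rintro v w (hvw | ⟨hv, hw, -⟩ | ⟨hv, hw, -⟩)
    · exact hG.ne_color v w hvw
    · rw [hv]; exact hw.symm
    · rw [hw]; exact hv

/-- A cut of the remaining colors extends to `A` by putting `c` on the side of `d`. If the crossing
link uses `c`, contraction provides a link with `d` in its place. -/
theorem cutConnected_contractColor [DecidableEq C] (h : IsCoherent χ) (hG : IsCrossGraph χ G)
    {A : Finset C} (hA : CutConnected (ColorLink χ G) (A : Set C)) {c d : C}
    (hd : d ∈ A) (hcd : c ≠ d) (hl : ColorLink χ G c d) :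
    CutConnected (ColorLink χ (contractColor χ G c d)) (A.erase c : Set C) := by
  have key : ∀ e, e ≠ d → ColorLink χ G c e → ColorLink χ (contractColor χ G c d) d e := by
    rintro e hed ⟨x, w, hx, hw, hxw⟩
    obtain ⟨y, hy, hxy⟩ := hl.exists_adj h hG hx
    exact ⟨y, w, hy, hw, .inr (.inl ⟨hy, hw ▸ hed, x, ⟨hxy.symm, hx⟩, hxw⟩)⟩
  have hmono : ∀ e f, ColorLink χ G e f → ColorLink χ (contractColor χ G c d) e f :=
    fun e f ⟨v, w, hv, hw, hvw⟩ => ⟨v, w, hv, hw, .inl hvw⟩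
  have hdA : d ∈ (A.erase c : Set C) := Finset.mem_erase.2 ⟨hcd.symm, hd⟩
  rintro X ⟨p, hp, hpX⟩ ⟨q, hq, hqX⟩
  have hp' := Finset.mem_erase.1 hp
  have hq' := Finset.mem_erase.1 hq
  obtain ⟨b, hb, hbX, e, he, heX, hbe⟩ := hA {e | (e = c ∧ d ∈ X) ∨ (e ≠ c ∧ e ∈ X)}
    ⟨p, hp'.2, .inr ⟨hp'.1, hpX⟩⟩ ⟨q, hq'.2, by
      rintro (⟨h1, -⟩ | ⟨-, h2⟩)
      · exact hq'.1 h1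
      · exact hqX h2⟩
  have heX' : (e = c → d ∉ X) ∧ (e ≠ c → e ∉ X) :=
    ⟨fun h1 h2 => heX (.inl ⟨h1, h2⟩), fun h1 h2 => heX (.inr ⟨h1, h2⟩)⟩
  rcases hbX with ⟨rfl, hdX⟩ | ⟨hbc, hbX⟩
  · have hec : e ≠ b := fun hec => heX'.1 hec hdX
    exact ⟨d, hdA, hdX, e, Finset.mem_erase.2 ⟨hec, he⟩, heX'.2 hec,
      key e (fun hed => heX'.2 hec (hed ▸ hdX)) hbe⟩
  · by_cases hec : e = c
    · subst hec
      have hdX := heX'.1 rfl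
      exact ⟨b, Finset.mem_erase.2 ⟨hbc, hb⟩, hbX, d, hdA, hdX,
        (key b (fun hbd => hdX (hbd ▸ hbX)) hbe.symm).symm⟩
    · exact ⟨b, Finset.mem_erase.2 ⟨hbc, hb⟩, hbX, e, Finset.mem_erase.2 ⟨hec, he⟩, heX'.2 hec,
        hmono _ _ hbe⟩

/-- If every vertex of color `c` has only one neighbor of color `d`, then a triple model of the
contracted graph lifts. -/
theorem IsTripleModel.of_contractColor [DecidableEq C] (h : IsCoherent χ) (hG : IsCrossGraph χ G)
    {A : Finset C} {c d : C} (hc : c ∈ A) (hd : d ∈ A) (hcd : c ≠ d) (hl : ColorLink χ G c d)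
    (huniq : ∀ x w w', χ x x = c → χ w w = d → χ w' w' = d → G.Adj x w → G.Adj x w' → w = w')
    {S : Fin 3 → Set V} (hS : IsTripleModel χ (contractColor χ G c d) (A.erase c) S) :
    IsTripleModel χ G A fun r => S r ∪ {x | χ x x = c ∧ ∃ v ∈ S r, χ v v = d ∧ G.Adj x v} := by
  have hcS : ∀ r, ∀ v ∈ S r, χ v v ≠ c := fun r v hv =>
    (Finset.mem_erase.1 (hS.color_mem r v hv)).1
  refine ⟨?_, ?_, ?_, ?_⟩
  · rintro r s x (hr | ⟨hxc, v, hv, hvd, hxv⟩) (hs | ⟨hxc', w, hw, hwd, hxw⟩)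
    · exact hS.disj r s x hr hs
    · exact absurd hxc' (hcS _ _ hr)
    · exact absurd hxc (hcS _ _ hs)
    -- The lifted parts stay disjoint because a vertex of color `c` joins only the part of its
    -- unique neighbor of color `d`.
    · obtain rfl := huniq x v w hxc hvd hwd hxv hxw
      exact hS.disj r s v hv hw
  · rintro r X ⟨x, hx, hxX⟩ ⟨y, hy, hyX⟩
    by_cases h1 : ∃ p ∈ S r, p ∈ X
    · by_cases h2 : ∃ q ∈ S r, q ∉ X
      · obtain ⟨p, hp, hpX, q, hq, hqX, hpq⟩ := hS.conn r X h1 h2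
        -- An added edge stands for a path through some `z` of color `c`. Its end of color `d` puts
        -- `z` into the lifted part, so one of the two steps of the path crosses `X`.
        have via : ∀ z, G.Adj p z → G.Adj z q →
            z ∈ S r ∪ {x | χ x x = c ∧ ∃ v ∈ S r, χ v v = d ∧ G.Adj x v} →
            ∃ x ∈ S r ∪ {x | χ x x = c ∧ ∃ v ∈ S r, χ v v = d ∧ G.Adj x v}, x ∈ X ∧
            ∃ y ∈ S r ∪ {x | χ x x = c ∧ ∃ v ∈ S r, χ v v = d ∧ G.Adj x v}, y ∉ X ∧
              G.Adj x y := by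
          intro z hpz hzq hz
          by_cases hzX : z ∈ X
          · exact ⟨z, hz, hzX, q, .inl hq, hqX, hzq⟩
          · exact ⟨p, .inl hp, hpX, z, hz, hzX, hpz⟩
        rcases hpq with hpq | ⟨hpd, -, z, ⟨hpz, hzc⟩, hzq⟩ | ⟨-, hqd, z, ⟨hpz, hzc⟩, hzq⟩
        · exact ⟨p, .inl hp, hpX, q, .inl hq, hqX, hpq⟩
        · exact via z hpz hzq (.inr ⟨hzc, p, hp, hpd, hpz.symm⟩)
        · exact via z hpz hzq (.inr ⟨hzc, q, hq, hqd, hzq⟩)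
      · push Not at h2
        rcases hy with hy | ⟨hyc, v, hv, hvd, hyv⟩
        · exact absurd (h2 y hy) hyX
        · exact ⟨v, .inl hv, h2 v hv, y, .inr ⟨hyc, v, hv, hvd, hyv⟩, hyX, hyv.symm⟩
    · push Not at h1
      rcases hx with hx | ⟨hxc, v, hv, hvd, hxv⟩
      · exact absurd hxX (h1 x hx)
      · exact ⟨x, .inr ⟨hxc, v, hv, hvd, hxv⟩, hxX, v, .inl hv, h1 v hv, hxv⟩
  · rintro r x (hx | ⟨hxc, -⟩)
    · exact (Finset.mem_erase.1 (hS.color_mem r x hx)).2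
    · exact hxc ▸ hc
  · intro r e he
    by_cases hec : e = c
    · obtain ⟨v, hv, hvd⟩ := hS.meets r d (Finset.mem_erase.2 ⟨hcd.symm, hd⟩)
      obtain ⟨x, hx, hvx⟩ := hl.symm.exists_adj h hG hvd
      exact ⟨x, .inr ⟨hx, v, hv, hvd, hvx.symm⟩, hx.trans hec.symm⟩
    · obtain ⟨v, hv, hve⟩ := hS.meets r e (Finset.mem_erase.2 ⟨hec, he⟩)
      exact ⟨v, .inl hv, hve⟩

/-- If one vertex of color `c` has at most one neighbor of color `d`, so do all. -/
theorem IsCrossGraph.unique_neighbor (h : IsCoherent χ) (hG : IsCrossGraph χ G) {c d : C}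
    {x y : V} (hx : χ x x = c) (hxy : ∀ z, χ z z = d → G.Adj x z → z = y) (x' w w' : V)
    (hx' : χ x' x' = c) (hw : χ w w = d) (hw' : χ w' w' = d) (hxw : G.Adj x' w)
    (hxw' : G.Adj x' w') : w = w' := by
  by_contra hne
  -- Having two distinct neighbors of color `d` is the existence of a closed walk through them,
  -- hence a property of the color of the diagonal pair.
  have hR := (hG.respects.and (h.respects_right (· = d))).comp
    (h.respects_ne.comp (hG.respects.and (h.respects_left (· = d))) h) h
  obtain ⟨z, ⟨hz, hzd⟩, z', hzz, hz', hzd'⟩ := hR x' x' x x (hx'.trans hx.symm)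
    ⟨w, ⟨hxw, hw⟩, w', hne, hxw'.symm, hw'⟩
  exact hzz ((hxy z hzd hz).trans (hxy z' hzd' hz'.symm).symm)

end Contraction

/-! ### Extending a model by one color -/

section Separators

variable {V C : Type*} [DecidableEq C] {χ : V → V → C} {G : SimpleGraph V} {A : Finset C}

/-- A vertex with a neighbor of a color in `A` has another such neighbor. -/
def HasManyNeighbors (χ : V → V → C) (G : SimpleGraph V) (A : Finset C) : Prop :=
  ∀ c ∈ A, ∀ d ∈ A, ColorLink χ G c d → ∀ x, χ x x = c → ∀ y, ∃ z, χ z z = d ∧ G.Adj x z ∧ z ≠ y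

/-- The color class `i` separates the graph in the way in which it does when no triple model
of the other colors extends to `i`. -/
structure IsSeparatorColor (χ : V → V → C) (G : SimpleGraph V) (A : Finset C) (i : C) : Prop where
  adj_of_reachable : ∀ x x' z z', χ x x ∈ A.erase i →
    Relation.ReflTransGen (AdjIn χ G (A.erase i)) x x' → χ z z = i → G.Adj x z →
    χ z' z' = i → G.Adj x' z' → G.Adj x' z
  exists_not_adj : ∀ x, χ x x ∈ A.erase i → ∃ z, χ z z = i ∧ ¬ G.Adj x z
  reachable : ∀ v w, χ v v ∈ A → χ w w ∈ A → Relation.ReflTransGen (AdjIn χ G A) v w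

theorem IsTripleModel.extend {i : C} (hi : i ∈ A) {S : Fin 3 → Set V}
    (hS : IsTripleModel χ G (A.erase i) S) {z : Fin 3 → V} (hz : Function.Injective z)
    (hzi : ∀ r, χ (z r) (z r) = i) (hadj : ∀ r, ∃ x ∈ S r, G.Adj x (z r)) :
    IsTripleModel χ G A fun r => insert (z r) (S r) := by
  have hiS : ∀ r, ∀ v ∈ S r, χ v v ≠ i := fun r v hv =>
    (Finset.mem_erase.1 (hS.color_mem r v hv)).1
  refine ⟨?_, ?_, ?_, ?_⟩
  · rintro r s x (rfl | hr) (hs | hs)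
    · exact hz hs
    · exact absurd (hzi _) (hiS _ _ hs)
    · exact absurd (hs ▸ hzi _) (hiS _ _ hr)
    · exact hS.disj _ _ _ hr hs
  · intro r
    obtain ⟨x, hx, hxz⟩ := hadj r
    exact (hS.conn r).insert (fun _ _ h => h.symm) hx hxz
  · rintro r x (rfl | hx)
    · exact hzi r ▸ hi
    · exact Finset.mem_of_mem_erase (hS.color_mem r x hx)
  · intro r c hc
    by_cases hci : c = i
    · exact ⟨z r, .inl rfl, (hzi r).trans hci.symm⟩
    · obtain ⟨x, hx, hxc⟩ := hS.meets r c (Finset.mem_erase.2 ⟨hci, hc⟩)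
      exact ⟨x, .inr hx, hxc⟩

/-- If a triple model does not extend to the color `i`, then it has only two neighbors of this
color. -/
theorem IsTripleModel.exists_pair (h : IsCoherent χ) (hG : IsCrossGraph χ G)
    (hmany : HasManyNeighbors χ G A) {i c : C} (hi : i ∈ A) (hc : c ∈ A.erase i)
    (hic : ColorLink χ G i c) {S : Fin 3 → Set V} (hS : IsTripleModel χ G (A.erase i) S)
    (hno : ¬ ∃ S, IsTripleModel χ G A S) :
    ∃ a b, a ≠ b ∧ χ a a = i ∧ χ b b = i ∧
      ∀ r, ∀ x ∈ S r, ∀ z, χ z z = i → G.Adj x z → (z = a ∨ z = b) ∧ G.Adj x a ∧ G.Adj x b := by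
  have hmany' : ∀ r, ∀ x ∈ S r, ∀ z, χ z z = i → G.Adj x z →
      ∀ y, ∃ z, χ z z = i ∧ G.Adj x z ∧ z ≠ y := fun r x hx z hz hxz =>
    hmany _ (Finset.mem_of_mem_erase (hS.color_mem r x hx)) i hi ⟨x, z, rfl, hz, hxz⟩ x rfl
  have hex : ∀ r, ∃ x ∈ S r, ∃ z, χ z z = i ∧ G.Adj x z := by
    intro r
    obtain ⟨x, hx, hxc⟩ := hS.meets r c hc
    exact ⟨x, hx, hic.symm.exists_adj h hG hxc⟩
  -- The sets to be represented are the neighborhoods of the three parts in class `i`.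
  rcases exists_distinct_or_subset_pair (fun r => {z | χ z z = i ∧ ∃ x ∈ S r, G.Adj x z})
    (fun r => by
      obtain ⟨x, hx, z, hz, hxz⟩ := hex r
      exact ⟨z, hz, x, hx, hxz⟩)
    (fun r y => by
      obtain ⟨x, hx, z, hz, hxz⟩ := hex r
      obtain ⟨z', hz', hxz', hne⟩ := hmany' r x hx z hz hxz y
      exact ⟨z', ⟨hz', x, hx, hxz'⟩, hne⟩) with ⟨z, hz, hzN⟩ | ⟨a, b, hab, hN⟩
  · exact absurd ⟨_, hS.extend hi hz (fun r => (hzN r).1) fun r => (hzN r).2⟩ hno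
  · have hN' : ∀ r, ∀ x ∈ S r, ∀ z, χ z z = i → G.Adj x z → z = a ∨ z = b :=
      fun r x hx z hz hxz => hN r z ⟨hz, x, hx, hxz⟩
    have hboth : ∀ r, ∀ x ∈ S r, ∀ z, χ z z = i → G.Adj x z →
        (χ a a = i ∧ G.Adj x a) ∧ (χ b b = i ∧ G.Adj x b) := by
      intro r x hx z hz hxz
      obtain ⟨p, hp, hxp, hpb⟩ := hmany' r x hx z hz hxz b
      obtain ⟨q, hq, hxq, hqa⟩ := hmany' r x hx z hz hxz a
      obtain rfl := (hN' r x hx p hp hxp).resolve_right hpb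
      obtain rfl := (hN' r x hx q hq hxq).resolve_left hqa
      exact ⟨⟨hp, hxp⟩, hq, hxq⟩
    obtain ⟨x, hx, z, hz, hxz⟩ := hex 0
    have hh := hboth 0 x hx z hz hxz
    refine ⟨a, b, hab, hh.1.1, hh.2.1, fun r x hx z hz hxz => ⟨hN' r x hx z hz hxz, ?_⟩⟩
    have hh' := hboth r x hx z hz hxz
    exact ⟨hh'.1.2, hh'.2.2⟩

end Separators

/-! ### Separator colors and their incompatibility -/

section TwoSeparators

variable {V C : Type*} [DecidableEq C] {χ : V → V → C} {G : SimpleGraph V} {A : Finset C}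

/-- If a triple model of `A.erase i` exists, but none of `A`, then `i` is a separator color. -/
theorem isSeparatorColor_of_not_exists [Finite V] (h : IsCoherent χ) (hG : IsCrossGraph χ G)
    (hA : CutConnected (ColorLink χ G) (A : Set C))
    (hthree : ∀ c ∈ A, ∃ x : Fin 3 → V, Function.Injective x ∧ ∀ r, χ (x r) (x r) = c)
    (hmany : HasManyNeighbors χ G A) {i c : C} (hi : i ∈ A) (hc : c ∈ A.erase i)
    (hic : ColorLink χ G i c) (hS₀ : ∃ S, IsTripleModel χ G (A.erase i) S)
    (hno : ¬ ∃ S, IsTripleModel χ G A S) : IsSeparatorColor χ G A i := by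
  obtain ⟨S₀, hS₀⟩ := hS₀
  obtain ⟨S, hS, hcl⟩ := hS₀.exists_closed
  obtain ⟨a, b, hab, hai, hbi, hpair⟩ := hS.exists_pair h hG hmany hi hc hic hno
  obtain ⟨t, hta, htb, hti⟩ : ∃ t, t ≠ a ∧ t ≠ b ∧ χ t t = i := by
    obtain ⟨x, hx, hxi⟩ := hthree i hi
    by_contra! hcon
    have hor : ∀ r, x r = a ∨ x r = b := fun r => by
      by_contra! hr
      exact hcon _ hr.1 hr.2 (hxi r)
    have h01 : x 0 ≠ x 1 := hx.ne (by decide)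
    have h02 : x 0 ≠ x 2 := hx.ne (by decide)
    have h12 : x 1 ≠ x 2 := hx.ne (by decide)
    rcases hor 0 with h0 | h0 <;> rcases hor 1 with h1 | h1 <;> rcases hor 2 with h2 | h2 <;>
      simp_all
  by_cases hreach : ∀ v, χ v v ∈ A → Relation.ReflTransGen (AdjIn χ G A) a v
  · refine ⟨?_, ?_, fun v w hv hw => (reachable_symm (hreach v hv)).trans (hreach w hw)⟩
    · intro x x' z z' hx hxx' hz hxz hz' hxz'
      -- The pair (`x`, `x'`) is copied to an equally colored pair starting in the model. The parts
      -- together are closed under adjacency, so the copy of `x'` lies in one of them and sees both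
      -- `a` and `b`.
      obtain ⟨x₀, hx₀, hx₀x⟩ := hS.meets 0 _ hx
      obtain ⟨x₀', hcol⟩ := h.exists_color_eq hx₀x.symm x'
      have hr := (hG.respects_adjIn h (A.erase i)).reflTransGen h _ _ _ _ hcol hxx'
      obtain ⟨s, hs⟩ := Set.mem_iUnion.1 <| mem_of_reachable (T := ⋃ r, S r)
        (fun v hv w hvw => by
          obtain ⟨r, hr⟩ := Set.mem_iUnion.1 hv
          exact Set.mem_iUnion.2 (hcl r v hr w hvw)) hr (Set.mem_iUnion.2 ⟨0, hx₀⟩)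
      obtain ⟨z₀, hz₀⟩ := h.exists_color_eq (h.color_right hcol) z'
      have hadj := (hpair s x₀' hs z₀ ((h.color_right hz₀).symm.trans hz')
        (hG.respects _ _ _ _ hz₀ hxz')).2
      -- The relation: no neighbor of color `i` of the first vertex is a non-neighbor of the second.
      have hR := ((hG.respects.and (h.respects_right (· = i))).comp hG.respects.not h).not
      have hF := hR _ _ _ _ hcol.symm (by
        rintro ⟨p, ⟨hp, hpi⟩, hp'⟩
        rcases (hpair 0 x₀ hx₀ p hpi hp).1 with rfl | rfl
        · exact hp' hadj.1.symm
        · exact hp' hadj.2.symm)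
      by_contra hcon
      exact hF ⟨z, ⟨hxz, hz⟩, fun hzx => hcon hzx.symm⟩
    · intro x hx
      obtain ⟨x₀, hx₀, hx₀x⟩ := hS.meets 0 _ hx
      obtain ⟨z, hz⟩ := h.exists_color_eq hx₀x t
      have hzi : χ z z = i := (h.color_right hz).symm.trans hti
      refine ⟨z, hzi, fun hxz => ?_⟩
      rcases (hpair 0 x₀ hx₀ t hti (hG.respects _ _ _ _ hz.symm hxz)).1 with h1 | h1
      · exact hta h1
      · exact htb h1
  · push Not at hreach
    obtain ⟨v, hv, hav⟩ := hreach
    have haA : χ a a ∈ A := hai ▸ hi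
    have hiS : ∀ r, ∀ v ∈ S r, χ v v ≠ i := fun r v hv =>
      (Finset.mem_erase.1 (hS.color_mem r v hv)).1
    have hfull : ∀ r, ∃ x ∈ S r, G.Adj x a ∧ G.Adj x b := by
      intro r
      obtain ⟨x, hx, hxc⟩ := hS.meets r c hc
      obtain ⟨z, hz, hxz⟩ := hic.symm.exists_adj h hG hxc
      exact ⟨x, hx, (hpair r x hx z hz hxz).2⟩
    have hSA : ∀ r, ∀ x ∈ S r, χ x x ∈ A := fun r x hx =>
      Finset.mem_of_mem_erase (hS.color_mem r x hx)
    have hSr : ∀ r, ∀ x ∈ S r, Relation.ReflTransGen (AdjIn χ G A) a x := by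
      intro r
      obtain ⟨x, hx, hxa, -⟩ := hfull r
      exact (hS.conn r).subset_of_closed (T := {x | Relation.ReflTransGen (AdjIn χ G A) a x}) hx
        (.single ⟨haA, hSA r x hx, hxa.symm⟩)
        fun p hp q hq hpq => hp.tail ⟨color_mem_of_reachable hp haA, hSA r q hq, hpq⟩
    have hbr : Relation.ReflTransGen (AdjIn χ G A) a b := by
      obtain ⟨x, hx, -, hxb⟩ := hfull 0
      exact (hSr 0 x hx).tail ⟨hSA 0 x hx, hbi ▸ hi, hxb⟩
    -- All parts lie in the component of `a`. Two of them are completed by `a` and `b`; the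
    -- component of `v` is the third part, as every component meets every class.
    refine absurd ⟨![insert a (S 0), insert b (S 1),
      {w | Relation.ReflTransGen (AdjIn χ G A) v w}], ?_⟩ hno
    have hoff : ∀ w, Relation.ReflTransGen (AdjIn χ G A) v w →
        ¬ Relation.ReflTransGen (AdjIn χ G A) a w :=
      fun w hw haw => hav (haw.trans (reachable_symm hw))
    have h0 : ∀ w ∈ insert a (S 0), Relation.ReflTransGen (AdjIn χ G A) a w := by
      rintro w (rfl | hw)
      exacts [.refl, hSr 0 w hw]
    have h1 : ∀ w ∈ insert b (S 1), Relation.ReflTransGen (AdjIn χ G A) a w := by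
      rintro w (rfl | hw)
      exacts [hbr, hSr 1 w hw]
    have h01 : ∀ w ∈ insert a (S 0), w ∉ insert b (S 1) := by
      rintro w (rfl | hw) (hw' | hw')
      · exact hab hw'
      · exact hiS 1 _ hw' hai
      · exact hiS 0 _ hw (hw' ▸ hbi)
      · exact absurd (hS.disj _ _ _ hw hw') (by decide)
    have hmeets : ∀ (p : V) (r : Fin 3), χ p p = i → ∀ e ∈ A, ∃ w ∈ insert p (S r), χ w w = e := by
      intro p r hp e he
      by_cases hei : e = i
      · exact ⟨p, .inl rfl, hp.trans hei.symm⟩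
      · obtain ⟨w, hw, hwe⟩ := hS.meets r e (Finset.mem_erase.2 ⟨hei, he⟩)
        exact ⟨w, .inr hw, hwe⟩
    refine ⟨?_, ?_, ?_, ?_⟩
    · intro r s w hr hs
      fin_cases r <;> fin_cases s
      · rfl
      · exact absurd hs (h01 w hr)
      · exact absurd (h0 w hr) (hoff w hs)
      · exact absurd hr (h01 w hs)
      · rfl
      · exact absurd (h1 w hr) (hoff w hs)
      · exact absurd (h0 w hs) (hoff w hr)
      · exact absurd (h1 w hs) (hoff w hr)
      · rfl
    · intro r
      fin_cases r
      · obtain ⟨x, hx, hxa, -⟩ := hfull 0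
        exact (hS.conn 0).insert (fun _ _ h => h.symm) hx hxa
      · obtain ⟨x, hx, -, hxb⟩ := hfull 1
        exact (hS.conn 1).insert (fun _ _ h => h.symm) hx hxb
      · exact cutConnected_reachable v
    · intro r w hw
      fin_cases r
      · exact color_mem_of_reachable (h0 w hw) haA
      · exact color_mem_of_reachable (h1 w hw) haA
      · exact color_mem_of_reachable hw hv
    · intro r e he
      fin_cases r
      · exact hmeets a 0 hai e he
      · exact hmeets b 1 hbi e he
      · exact exists_reachable_color h hG hA hv he

/-- Two colors that can be removed without disconnecting the color graph are not both separator
colors. -/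
theorem IsSeparatorColor.false_of_two (h : IsCoherent χ) (hG : IsCrossGraph χ G) {i j c d : C}
    (hne : ∀ e ∈ A, ∃ v, χ v v = e) (hi : i ∈ A) (hj : j ∈ A) (hij : i ≠ j)
    (hAi : CutConnected (ColorLink χ G) (A.erase i : Set C))
    (hAj : CutConnected (ColorLink χ G) (A.erase j : Set C))
    (hsi : IsSeparatorColor χ G A i) (hsj : IsSeparatorColor χ G A j)
    (hc : c ∈ A) (hci : c ≠ i) (hcj : c ≠ j) (hic : ColorLink χ G i c)
    (hd : d ∈ A) (hdi : d ≠ i) (hdj : d ≠ j) (hjd : ColorLink χ G j d) : False := by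
  obtain ⟨y, hy⟩ := hne d hd
  have hyi : χ y y ∈ A.erase i := Finset.mem_erase.2 ⟨hy ▸ hdi, hy ▸ hd⟩
  have hyj : χ y y ∈ A.erase j := Finset.mem_erase.2 ⟨hy ▸ hdj, hy ▸ hd⟩
  -- Let K and L be the components of `y` without class `i` and without class `j`. A vertex of color
  -- `j` attached to L is adjacent to `y` itself, hence lies in K.
  have hjL : ∀ p, χ p p = j → ∀ m, Relation.ReflTransGen (AdjIn χ G (A.erase j)) y m →
      G.Adj m p → Relation.ReflTransGen (AdjIn χ G (A.erase i)) y p := by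
    intro p hp m hm hmp
    obtain ⟨q, hq, hyq⟩ := hjd.symm.exists_adj h hG hy
    have hyp := hsj.adj_of_reachable m y p q (color_mem_of_reachable hm hyj) (reachable_symm hm)
      hp hmp hq hyq
    exact .single ⟨hyi, Finset.mem_erase.2 ⟨hp ▸ hij.symm, hp ▸ hj⟩, hyp⟩
  -- All neighbors of a vertex of color `i` in L lie in K.
  have hnbr : ∀ a, χ a a = i → Relation.ReflTransGen (AdjIn χ G (A.erase j)) y a →
      ∀ x, χ x x ∈ A → G.Adj a x → Relation.ReflTransGen (AdjIn χ G (A.erase i)) y x := by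
    intro a ha hya x hx hax
    by_cases hxj : χ x x = j
    · exact hjL x hxj a hya hax
    · have hxi : χ x x ≠ i := fun hxi => hG.ne_color a x hax (ha.trans hxi.symm)
      have hxA : χ x x ∈ A.erase i := Finset.mem_erase.2 ⟨hxi, hx⟩
      have hyx := hya.tail ⟨color_mem_of_reachable hya hyj, Finset.mem_erase.2 ⟨hxj, hx⟩, hax⟩
      by_contra hcon
      -- If `x` were outside K, its component without class `i` could not leave L, since an exit has
      -- color `j` and lies in K by `hjL`. But that component must meet class `j`, which L avoids.
      obtain ⟨w, hw, hwj⟩ := exists_mem_of_closed h hG hAi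
        (T := {w | Relation.ReflTransGen (AdjIn χ G (A.erase i)) x w ∧
          Relation.ReflTransGen (AdjIn χ G (A.erase j)) y w})
        (by
          rintro v ⟨hv1, hv2⟩ w hvw
          refine ⟨hv1.tail hvw, ?_⟩
          by_cases hwj : χ w w = j
          · exact absurd ((hjL w hwj v hv2 hvw.2.2).trans (reachable_symm (hv1.tail hvw))) hcon
          · exact hv2.tail ⟨color_mem_of_reachable hv2 hyj,
              Finset.mem_erase.2 ⟨hwj, Finset.mem_of_mem_erase hvw.2.1⟩, hvw.2.2⟩)
        ⟨.refl, hyx⟩ hxA (Finset.mem_erase.2 ⟨hij.symm, hj⟩)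
      exact (Finset.mem_erase.1 (color_mem_of_reachable hw.2 hyj)).1 hwj
  obtain ⟨a, hya, ha⟩ := exists_reachable_color h hG hAj hyj (Finset.mem_erase.2 ⟨hij, hi⟩)
  obtain ⟨x, hx, hax⟩ := hic.exists_adj h hG ha
  have hxA : χ x x ∈ A := hx ▸ hc
  have hyx := hnbr a ha hya x hxA hax
  have hyx' := hya.tail ⟨color_mem_of_reachable hya hyj,
    Finset.mem_erase.2 ⟨hx ▸ hcj, hxA⟩, hax⟩
  obtain ⟨z, hz, hxz⟩ := hsi.exists_not_adj x (Finset.mem_erase.2 ⟨hx ▸ hci, hxA⟩)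
  -- K together with the neighbors of `x` in class `i` is closed: vertices of K have no other
  -- neighbors in that class, and those neighbors lie in L, so `hnbr` applies. By connectivity it
  -- contains `z`, a non-neighbor of `x` of color `i`.
  have hcl := mem_of_reachable
    (T := {w | Relation.ReflTransGen (AdjIn χ G (A.erase i)) y w ∨ (χ w w = i ∧ G.Adj x w)})
    (by
      rintro v (hv | ⟨hvi, hxv⟩) w hvw
      · by_cases hwi : χ w w = i
        · exact .inr ⟨hwi, hsi.adj_of_reachable v x w a (color_mem_of_reachable hv hyi)
            ((reachable_symm hv).trans hyx) hwi hvw.2.2 ha hax.symm⟩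
        · exact .inl (hv.tail ⟨color_mem_of_reachable hv hyi,
            Finset.mem_erase.2 ⟨hwi, hvw.2.1⟩, hvw.2.2⟩)
      · exact .inl (hnbr v hvi (hyx'.tail ⟨color_mem_of_reachable hyx' hyj,
          Finset.mem_erase.2 ⟨hvi ▸ hij, hvi ▸ hi⟩, hxv⟩) w hvw.2.1 hvw.2.2))
    (hsi.reachable x z hxA (hz ▸ hi)) (.inl hyx)
  rcases hcl with hcl | ⟨-, hcl⟩
  · exact (Finset.mem_erase.1 (color_mem_of_reachable hcl hyi)).1 hz
  · exact hxz hcl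

/-- Two linked colors have a triple model, unless one of them determines the other. -/
theorem exists_isTripleModel_pair (h : IsCoherent χ) (hG : IsCrossGraph χ G) {i j : C}
    (hthree : ∀ c ∈ A, ∃ x : Fin 3 → V, Function.Injective x ∧ ∀ r, χ (x r) (x r) = c)
    (hmany : HasManyNeighbors χ G A) (hi : i ∈ A) (hA : A.erase i = {j})
    (hij : ColorLink χ G i j) : ∃ S, IsTripleModel χ G A S := by
  by_contra hno
  have hjA : j ∈ A.erase i := hA ▸ Finset.mem_singleton_self j
  obtain ⟨x, hx, hxj⟩ := hthree j (Finset.mem_of_mem_erase hjA)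
  have hmodel : ∀ y : Fin 3 → V, Function.Injective y → (∀ r, χ (y r) (y r) = j) →
      ∃ a b, ∀ r, ∀ z, χ z z = i → G.Adj (y r) z →
        (z = a ∨ z = b) ∧ (χ a a = i ∧ G.Adj (y r) a) ∧ (χ b b = i ∧ G.Adj (y r) b) := by
    intro y hy hyj
    have hS := isTripleModel_singleton (G := G) hy hyj
    rw [← hA] at hS
    obtain ⟨a, b, -, ha, hb, hab⟩ := hS.exists_pair h hG hmany hi hjA hij hno
    refine ⟨a, b, fun r z hz hyz => ?_⟩
    obtain ⟨h1, h2, h3⟩ := hab r (y r) rfl z hz hyz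
    exact ⟨h1, ⟨ha, h2⟩, hb, h3⟩
  obtain ⟨a, b, hab⟩ := hmodel x hx hxj
  have hall : ∀ t, χ t t = i → t = a ∨ t = b := by
    intro t ht
    by_contra hcon
    obtain ⟨w, hw, htw⟩ := hij.exists_adj h hG ht
    have hwx : ∀ r, w ≠ x r := by
      rintro r rfl
      exact hcon (hab r t ht htw.symm).1
    -- Exchanging one representative for `w` gives a new common pair, which contains `t`. Since `x
    -- 0` is kept, it is adjacent to `t`, so `t` was in the old pair.
    obtain ⟨a', b', hab'⟩ := hmodel (Function.update x 2 w)
      (by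
        intro r s hrs
        by_cases hr : r = 2 <;> by_cases hs : s = 2
        · exact hr.trans hs.symm
        · subst hr
          rw [Function.update_self, Function.update_of_ne hs] at hrs
          exact absurd hrs (hwx s)
        · subst hs
          rw [Function.update_self, Function.update_of_ne hr] at hrs
          exact absurd hrs.symm (hwx r)
        · rw [Function.update_of_ne hr, Function.update_of_ne hs] at hrs
          exact hx hrs)
      (by
        intro r
        by_cases hr : r = 2
        · subst hr
          rwa [Function.update_self]
        · rw [Function.update_of_ne hr]
          exact hxj r)
    have hw' := hab' 2 t ht (by rw [Function.update_self]; exact htw.symm)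
    obtain ⟨z, hz, hxz⟩ := hij.symm.exists_adj h hG (hxj 0)
    have hx' := (hab' 0 z hz (by rwa [Function.update_of_ne (by decide)])).2
    rw [Function.update_of_ne (by decide)] at hx'
    rcases hw'.1 with rfl | rfl
    · exact hcon (hab 0 _ hx'.1.1 hx'.1.2).1
    · exact hcon (hab 0 _ hx'.2.1 hx'.2.2).1
  obtain ⟨y, hy, hyi⟩ := hthree i hi
  have h01 : y 0 ≠ y 1 := hy.ne (by decide)
  have h02 : y 0 ≠ y 2 := hy.ne (by decide)
  have h12 : y 1 ≠ y 2 := hy.ne (by decide)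
  rcases hall _ (hyi 0) with h0 | h0 <;> rcases hall _ (hyi 1) with h1 | h1 <;>
    rcases hall _ (hyi 2) with h2 | h2 <;> simp_all

end TwoSeparators

/-! ### The induction on the set of colors -/

/-- A connected system of color classes with at least three elements each has a triple model. -/
theorem exists_isTripleModel {V C : Type*} [Finite V] [DecidableEq C] {χ : V → V → C}
    (h : IsCoherent χ) (A : Finset C) (hne : A.Nonempty)
    (hthree : ∀ c ∈ A, ∃ x : Fin 3 → V, Function.Injective x ∧ ∀ r, χ (x r) (x r) = c)
    (G : SimpleGraph V) (hG : IsCrossGraph χ G)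
    (hA : CutConnected (ColorLink χ G) (A : Set C)) : ∃ S, IsTripleModel χ G A S := by
  -- The graph varies because contraction changes it, while the coloring stays fixed.
  induction A using Finset.strongInduction generalizing G with
  | H A ih =>
  by_contra hno
  have hsymm : ∀ c d, ColorLink χ G c d → ColorLink χ G d c := fun _ _ hl => hl.symm
  have hlink_ne : ∀ c d, ColorLink χ G c d → c ≠ d := by
    rintro c d ⟨v, w, rfl, rfl, hvw⟩
    exact hG.ne_color v w hvw
  obtain ⟨e, he⟩ := hne
  obtain ⟨f, hf, hfe⟩ : ∃ f ∈ A, f ≠ e := by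
    by_contra! hcon
    obtain rfl : A = {e} := Finset.eq_singleton_iff_unique_mem.2 ⟨he, hcon⟩
    obtain ⟨x, hx, hxe⟩ := hthree e he
    exact hno ⟨_, isTripleModel_singleton hx hxe⟩
  have hmany : HasManyNeighbors χ G A := by
    intro c hc d hd hcd x hx y
    by_contra! hcon
    have hne := hlink_ne c d hcd
    obtain ⟨S, hS⟩ := ih (A.erase c) (Finset.erase_ssubset hc)
      ⟨d, Finset.mem_erase.2 ⟨hne.symm, hd⟩⟩
      (fun c' hc' => hthree c' (Finset.mem_of_mem_erase hc')) _ (hG.contractColor h c d)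
      (cutConnected_contractColor h hG hA hd hne hcd)
    exact hno ⟨_, hS.of_contractColor h hG hc hd hne hcd (hG.unique_neighbor h hx hcon)⟩
  obtain ⟨j, hj, hje, hAj⟩ := hA.exists_erase hsymm he hf hfe
  obtain ⟨i, hi, hij, hAi⟩ := hA.exists_erase hsymm hj he hje.symm
  have hmodel : ∀ k l, k ∈ A → l ∈ A → l ≠ k → CutConnected (ColorLink χ G) (A.erase k : Set C) →
      ∃ S, IsTripleModel χ G (A.erase k) S := fun k l hk hl hlk hAk =>
    ih (A.erase k) (Finset.erase_ssubset hk) ⟨l, Finset.mem_erase.2 ⟨hlk, hl⟩⟩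
      (fun c' hc' => hthree c' (Finset.mem_of_mem_erase hc')) G hG hAk
  have hSi := hmodel i j hi hj hij.symm hAi
  have hSj := hmodel j i hj hi hij hAj
  by_cases hthird : ∃ k ∈ A, k ≠ i ∧ k ≠ j
  · obtain ⟨k, hk, hki, hkj⟩ := hthird
    -- Cutting off `i` after deleting `j` gives `i` a linked color other than `j`; this is where a
    -- third color is needed.
    obtain ⟨_, -, rfl, c, hc, hci, hic⟩ := hAj {i} ⟨i, Finset.mem_erase.2 ⟨hij, hi⟩, rfl⟩
      ⟨k, Finset.mem_erase.2 ⟨hkj, hk⟩, hki⟩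
    obtain ⟨_, -, rfl, d, hd, hdj, hjd⟩ := hAi {j} ⟨j, Finset.mem_erase.2 ⟨hij.symm, hj⟩, rfl⟩
      ⟨k, Finset.mem_erase.2 ⟨hki, hk⟩, hkj⟩
    obtain ⟨hcj, hc⟩ := Finset.mem_erase.1 hc
    obtain ⟨hdi, hd⟩ := Finset.mem_erase.1 hd
    have hsi := isSeparatorColor_of_not_exists h hG hA hthree hmany hi
      (Finset.mem_erase.2 ⟨hci, hc⟩) hic hSi hno
    have hsj := isSeparatorColor_of_not_exists h hG hA hthree hmany hj
      (Finset.mem_erase.2 ⟨hdj, hd⟩) hjd hSj hno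
    exact IsSeparatorColor.false_of_two h hG
      (fun e he => let ⟨x, _, hx⟩ := hthree e he; ⟨x 0, hx 0⟩)
      hi hj hij hAi hAj hsi hsj hc hci hcj hic hd hdi hdj hjd
  · push Not at hthird
    have hAij : A.erase i = {j} := by
      refine Finset.eq_singleton_iff_unique_mem.2 ⟨Finset.mem_erase.2 ⟨hij.symm, hj⟩, ?_⟩
      intro k hk
      obtain ⟨hki, hk⟩ := Finset.mem_erase.1 hk
      exact hthird k hk hki
    obtain ⟨_, -, rfl, c, hc, hci, hic⟩ := hA {i} ⟨i, hi, rfl⟩ ⟨j, hj, hij.symm⟩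
    obtain rfl := hthird c hc hci
    exact hno (exists_isTripleModel_pair h hG hthree hmany hi hAij hic)

/-! ### From 2-stable colorings to triple models -/

theorem IsTwoStable.isCoherent {V C : Type*} [Fintype V] {G : SimpleGraph V} {χ : V → V → C}
    (h : IsTwoStable G χ) : IsCoherent χ where
  diag v w v' w' hc hvw := by
    have := congrArg Prod.fst (h.1 v w v' w' hc)
    simp only [wlInit] at this
    exact this.mp hvw
  tri v w v' w' hc x := by
    have hm := congrArg Prod.snd (h.2.2 v w v' w' hc)
    simp only [wlRound] at hm
    have hx : (χ x w, χ v x) ∈ (Finset.univ : Finset V).val.map fun x => (χ x w, χ v x) :=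
      Multiset.mem_map.2 ⟨x, Finset.mem_univ_val x, rfl⟩
    rw [hm] at hx
    obtain ⟨x', -, hx'⟩ := Multiset.mem_map.1 hx
    exact ⟨x', congrArg Prod.snd hx', congrArg Prod.fst hx'⟩

/-- The subgraph formed by the edges between vertices of different colors. -/
def crossEdges {V C : Type*} (G : SimpleGraph V) (χ : V → V → C) : SimpleGraph V where
  Adj v w := G.Adj v w ∧ χ v v ≠ χ w w
  symm := ⟨fun _ _ h => ⟨h.1.symm, h.2.symm⟩⟩
  loopless := ⟨fun _ h => h.2 rfl⟩

/-- The color of a pair determines adjacency and the colors of both ends. -/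
theorem IsTwoStable.isCrossGraph {V C : Type*} [Fintype V] {G : SimpleGraph V} {χ : V → V → C}
    (h : IsTwoStable G χ) : IsCrossGraph χ (crossEdges G χ) where
  respects v w v' w' hc hvw := by
    have := congrArg Prod.snd (h.1 v w v' w' hc)
    simp only [wlInit] at this
    refine ⟨this.mp hvw.1, ?_⟩
    rw [← h.isCoherent.color_left hc, ← h.isCoherent.color_right hc]
    exact hvw.2
  ne_color _ _ hvw := hvw.2

theorem cutConnected_of_colorGraph_connected {V C : Type*} {G : SimpleGraph V} {χ : V → V → C}
    (h : (colorGraph G χ).Connected) :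
    CutConnected (ColorLink χ (crossEdges G χ)) (vertexColors χ) := by
  rintro X ⟨x, hx, hxX⟩ ⟨y, hy, hyX⟩
  obtain ⟨p⟩ := h.preconnected ⟨x, hx⟩ ⟨y, hy⟩
  -- A walk from inside `X` to outside has a step that crosses the cut.
  obtain ⟨d, -, hd₁, hd₂⟩ := p.exists_boundary_dart {c | (c : C) ∈ X} hxX hyX
  obtain ⟨hne, v, hv, w, hw, hvw⟩ := d.adj
  refine ⟨_, d.fst.2, hd₁, _, d.snd.2, hd₂, v, w, hv, hw, hvw, ?_⟩
  rw [hv, hw]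
  exact fun heq => hne (Subtype.ext heq)

theorem exists_injective_of_three_le_ncard {α : Type*} {s : Set α} (h : 3 ≤ s.ncard) :
    ∃ x : Fin 3 → α, Function.Injective x ∧ ∀ r, x r ∈ s := by
  have hfin : s.Finite := Set.finite_of_ncard_pos (by omega)
  have := hfin.fintype
  obtain ⟨f⟩ := Function.Embedding.nonempty_of_card_le (α := Fin 3) (β := s) (by
    rwa [Fintype.card_fin, ← Nat.card_eq_fintype_card, Nat.card_coe_set_eq])
  exact ⟨fun r => f r, Subtype.val_injective.comp f.injective, fun r => (f r).2⟩

theorem mainTheorem6 {V C : Type*} [Fintype V] (G : SimpleGraph V) (χ : V → V → C)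
    (hχ : IsTwoStable G χ)
    (hconn : (colorGraph G χ).Connected)
    (hcard : ∀ c ∈ vertexColors χ, 3 ≤ (colorClass χ c).ncard) :
    ∃ H : Fin 3 → G.Subgraph,
      (∀ r s : Fin 3, r ≠ s → Disjoint (H r).verts (H s).verts) ∧
      (∀ r : Fin 3, (H r).Connected) ∧
      (∀ r : Fin 3, ∀ c ∈ vertexColors χ, ((H r).verts ∩ colorClass χ c).Nonempty) := by
  classical
  have hfin : (vertexColors χ).Finite := Set.finite_range _
  have hcut := cutConnected_of_colorGraph_connected hconn
  rw [← hfin.coe_toFinset] at hcut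
  obtain ⟨c₀, hc₀⟩ := hconn.nonempty
  obtain ⟨S, hS⟩ := exists_isTripleModel hχ.isCoherent hfin.toFinset
    ⟨c₀, hfin.mem_toFinset.2 hc₀⟩
    (fun c hc => exists_injective_of_three_le_ncard (hcard c (hfin.mem_toFinset.1 hc)))
    _ hχ.isCrossGraph hcut
  have hmeets : ∀ r, ∀ c ∈ vertexColors χ, (S r ∩ colorClass χ c).Nonempty := fun r c hc =>
    hS.meets r c (hfin.mem_toFinset.2 hc)
  refine ⟨fun r => (⊤ : G.Subgraph).induce (S r), ?_, ?_, hmeets⟩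
  · intro r s hrs
    exact Set.disjoint_left.2 fun v hr hs => hrs (hS.disj r s v hr hs)
  · intro r
    exact ((hS.conn r).mono fun _ _ hvw => hvw.1).subgraph_connected ((hmeets r c₀ hc₀).mono
      Set.inter_subset_left)
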